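/- Let $n,m\ge 1$ be integers and let $M_k$ denote the C*-algebra of complex $k\times k$ matrices with the operator norm; identify $M_n\otimes M_m$ with $M_{nm}$. An element of $M_n\otimes M_m$ is called separable if it is a finite sum $\sum_i P_i\otimes Q_i$ with $0\le P_i\in M_n$ and $0\le Q_i\in M_m$. A linear map $\Phi:M_n\to M_m$ is positive if it maps positive semidefinite matrices to positive semidefinite matrices, and $\|\Phi\|_{cb}=\sup_{k}\|\mathrm{Id}_k\otimes\Phi: M_k\otimes M_n\to M_k\otimes M_m\|$. Put $$\gamma(M_n,M_m)=\sup\{r\ge 0:\ 1_n\otimes 1_m-x\text{ is separable for all }x=x^*\in M_n\otimes M_m\text{ with }\|x\|\le r\},$$ $$\eta(M_n,M_m)=\sup\{\|\Phi\|_{cb}:\ \Phi:M_n\to M_m\text{ linear, positive, }\|\Phi\|\le 1\},$$ $$\eta_u(M_n,M_m)=\sup\{\|\Phi\|_{cb}:\ \Phi:M_n\to M_m\text{ linear, positive, }\Phi(1_n)=1_m\}.$$ Then $$\gamma(M_n,M_m)=\frac1{\min(n,m)}\qquad\text{and}\qquad \eta(M_n,M_m)=\eta_u(M_n,M_m)=\min(n,m).$$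 Moreover both suprema $\eta(M_n,M_m)$ and $\eta_u(M_n,M_m)$ are attained: there are a contractive positive map and a unital positive map $M_n\to M_m$ with cb norm exactly $\min(n,m)$. -/

import Mathlib

open scoped NNReal ENNReal Matrix Kronecker MatrixOrder ComplexOrder Matrix.Norms.L2Operator

/-- The algebra `M_n` of complex `n × n` matrices. Its norm is the C⋆-norm (the `ℓ²` operator
norm) and its order is the Loewner order, `0 ≤ A ↔ A.PosSemidef`. -/
abbrev MatAlg (n : ℕ) : Type := Matrix (Fin n) (Fin n) ℂ

/-- The tensor product `M_n ⊗ M_m`, realised as the `nm × nm` matrices indexed by pairs, with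
the operator norm; the elementary tensor of `a` and `b` is the Kronecker product `a ⊗ₖ b`. -/
abbrev BipartiteMat (n m : ℕ) : Type := Matrix (Fin n × Fin m) (Fin n × Fin m) ℂ

/-- The operator norm of a linear map between matrix algebras, both carrying the C⋆-norm. -/
noncomputable def mapNorm {ι κ : Type} [Fintype ι] [DecidableEq ι] [Fintype κ] [DecidableEq κ]
    (Φ : Matrix ι ι ℂ →ₗ[ℂ] Matrix κ κ ℂ) : ℝ :=
  ‖LinearMap.toContinuousLinearMap Φ‖

/-- The amplification `Φ_k = Id_k ⊗ Φ : M_k(M_n) → M_k(M_m)`, which applies `Φ` to every block;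
`M_k(M_n)` is identified with `M_k ⊗ M_n` by forgetting the block structure. -/
def amplify (k : ℕ) {n m : ℕ} (Φ : MatAlg n →ₗ[ℂ] MatAlg m) :
    BipartiteMat k n →ₗ[ℂ] BipartiteMat k m :=
  (Matrix.compLinearEquiv (Fin k) (Fin k) (Fin m) (Fin m) ℂ ℂ).toLinearMap ∘ₗ
    Φ.mapMatrix ∘ₗ
      (Matrix.compLinearEquiv (Fin k) (Fin k) (Fin n) (Fin n) ℂ ℂ).symm.toLinearMap

/-- The completely bounded norm `‖Φ‖_cb = sup_k ‖Φ_k‖`, with values in `[0, ∞]`. -/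
noncomputable def cbNorm {n m : ℕ} (Φ : MatAlg n →ₗ[ℂ] MatAlg m) : ℝ≥0∞ :=
  ⨆ k : ℕ, ENNReal.ofReal (mapNorm (amplify k Φ))

/-- `X ∈ M_n ⊗ M_m` is separable if it is a finite sum of elementary tensors of positive
semidefinite matrices. -/
def IsSeparableMat {n m : ℕ} (X : BipartiteMat n m) : Prop :=
  ∃ (N : ℕ) (P : Fin N → MatAlg n) (Q : Fin N → MatAlg m),
    (∀ i, (P i).PosSemidef) ∧ (∀ i, (Q i).PosSemidef) ∧ X = ∑ i, P i ⊗ₖ Q i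

/-- `η(M_n, M_m)`: the supremum of the cb norms of the contractive positive maps. -/
noncomputable def etaMat (n m : ℕ) : ℝ≥0∞ :=
  ⨆ (Φ : MatAlg n →ₚ[ℂ] MatAlg m) (_ : mapNorm Φ.toLinearMap ≤ 1), cbNorm Φ.toLinearMap

/-- `η_u(M_n, M_m)`: the supremum of the cb norms of the unital positive maps. -/
noncomputable def etaUnitalMat (n m : ℕ) : ℝ≥0∞ :=
  ⨆ (Φ : MatAlg n →ₚ[ℂ] MatAlg m) (_ : Φ 1 = 1), cbNorm Φ.toLinearMap

/-- `γ(M_n, M_m)`: the supremum of the radii `r ≥ 0` such that `1 ⊗ 1 - x` is separable for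
every self-adjoint `x` of norm at most `r`. -/
noncomputable def gammaMat (n m : ℕ) : ℝ≥0∞ :=
  ⨆ (r : ℝ≥0) (_ : ∀ x : BipartiteMat n m, x.IsHermitian → ‖x‖ ≤ r →
    IsSeparableMat ((1 : MatAlg n) ⊗ₖ (1 : MatAlg m) - x)), (r : ℝ≥0∞)

/-! Everything rests on one decomposition. A strict contraction is a combination `∑ c t • P t` of
positive matrices summing to `1` with unimodular coefficients. Let `y` be a Hermitian block matrix,
`d` blocks per row, whose blocks `y i j` are strict contractions. Decomposing each block and using
`v = e_i + star c • e_j` makes the sum of the `v v* ⊗ P` over the terms of block `(i, j)` equal to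
`(E_ii + E_jj) ⊗ 1 + E_ij ⊗ y i j + E_ji ⊗ y j i`. Half the sum over all `i, j` is `d • 1 + y`,
which is therefore separable (`card_smul_one_add_mem_sepCone`).

Rescaling, with the smaller tensor factor as block index, gives `γ ≥ 1 / min n m`. Equality holds
because pairing with the flip is nonnegative on separable elements, as `tr (P Q) ≥ 0`, but negative
on `1 - r F`, for the partial flip `F`, once `r > 1 / min n m`.

For `η ≤ n`, place `X` and `Xᴴ` off the diagonal of a Hermitian `y`. Then `n • 1 + y` is separable,
and amplifications of a positive map keep separable elements positive, which bounds the off-diagonal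
image by `n`. The bound by `m` needs contractivity only: the sesquilinear form is expanded over the
coordinates of `ℂ^m`. Transposition on a common corner attains `min n m`, since it turns the flip
into the rank-one matrix of the vector `∑ e_a ⊗ e_a`. -/

/-! ### Contractions as phase mixtures -/

/-- A matrix is a phase mixture if it is `∑ t, c t • P t` with unimodular scalars `c t` and positive
semidefinite `P t` that sum to `1`. -/
def IsPhaseMixture {κ : Type} [DecidableEq κ] (y : Matrix κ κ ℂ) : Prop :=
  ∃ (T : Type) (_ : Fintype T) (c : T → ℂ) (P : T → Matrix κ κ ℂ),
    (∀ t, ‖c t‖ = 1) ∧ (∀ t, (P t).PosSemidef) ∧ ∑ t, P t = 1 ∧ ∑ t, c t • P t = y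

theorem IsPhaseMixture.midpoint {κ : Type} [DecidableEq κ] {y z : Matrix κ κ ℂ} (hy : IsPhaseMixture y)
    (hz : IsPhaseMixture z) : IsPhaseMixture ((1 / 2 : ℂ) • (y + z)) := by
  obtain ⟨T, _, c, P, hc, hP, h1, hs⟩ := hy
  obtain ⟨T', _, c', P', hc', hP', h1', hs'⟩ := hz
  have h2 : (0 : ℂ) ≤ 1 / 2 := by simp
  refine ⟨T ⊕ T', inferInstance, Sum.elim c c',
    Sum.elim (fun t => (1 / 2 : ℂ) • P t) (fun t => (1 / 2 : ℂ) • P' t), ?_, ?_, ?_, ?_⟩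
  · rintro (t | t) <;> simp [hc, hc']
  · rintro (t | t)
    · exact (hP t).smul h2
    · exact (hP' t).smul h2
  · simp only [Fintype.sum_sum_type, Sum.elim_inl, Sum.elim_inr, ← Finset.smul_sum, h1, h1',
      ← smul_add, ← two_smul ℂ (1 : Matrix κ κ ℂ), smul_smul]
    norm_num
  · simp only [Fintype.sum_sum_type, Sum.elim_inl, Sum.elim_inr, smul_comm _ (1 / 2 : ℂ),
      ← Finset.smul_sum, hs, hs', ← smul_add]

section PhaseMixture

variable {κ : Type} [Fintype κ] [DecidableEq κ]

/-- Spectral theorem: the `P t` are the spectral projections and the `c t` the eigenvalues. The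
spectrum is finite, so indicators of its points are continuous on it and the functional calculus
applies. -/
theorem isPhaseMixture_of_mem_unitary {u : Matrix κ κ ℂ}
    (hu : u ∈ unitary (Matrix κ κ ℂ)) : IsPhaseMixture u := by
  have hfin : (spectrum ℂ u).Finite := Matrix.finite_spectrum u
  have hn : IsStarNormal u := ⟨by
    rw [Commute, SemiconjBy, (Unitary.mem_iff.1 hu).1, (Unitary.mem_iff.1 hu).2]⟩
  have hc : ∀ f : ℂ → ℂ, ContinuousOn f (spectrum ℂ u) := fun f => hfin.continuousOn f
  let S := hfin.toFinset
  let g : ℂ → ℂ → ℂ := fun z w => if w = z then 1 else 0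
  refine ⟨S, inferInstance, fun z => z, fun z => cfc (g z) u, ?_, ?_, ?_, ?_⟩
  · rintro ⟨z, hz⟩
    have := spectrum.subset_circle_of_unitary hu (hfin.mem_toFinset.1 hz)
    simpa using this
  · rintro ⟨z, hz⟩
    rw [← Matrix.nonneg_iff_posSemidef]
    refine cfc_nonneg fun w _ => ?_
    dsimp [g]
    split_ifs <;> simp
  · rw [← cfc_sum_univ _ _ (fun i => hc _), ← cfc_one ℂ u]
    refine cfc_congr fun w hw => ?_
    simp only [Finset.sum_apply, g, Pi.one_apply]
    rw [Finset.sum_coe_sort S (fun z => if w = z then (1 : ℂ) else 0)]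
    simp [S, hw]
  · have : ∀ z : S, (z : ℂ) • cfc (g z) u = cfc (fun w => (z : ℂ) • g z w) u :=
      fun z => (cfc_smul _ _ _ (hc _)).symm
    simp only [this]
    rw [← cfc_sum_univ _ _ (fun i => hc _)]
    conv_rhs => rw [← cfc_id ℂ u]
    refine cfc_congr fun w hw => ?_
    simp only [Finset.sum_apply, g]
    rw [Finset.sum_coe_sort S (fun z => z • if w = z then (1 : ℂ) else 0)]
    simp [S, hw]

/-- Polar decomposition `y = u h`, with `h` the midpoint of the unitary `w = h + i √(1 - h²)` and
its adjoint, so `y` is the midpoint of `u w` and `u w*`. Invertibility makes `u = y h⁻¹` unitary. -/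
theorem isPhaseMixture_of_isUnit {y : Matrix κ κ ℂ} (hy : IsUnit y) (hn : ‖y‖ ≤ 1) :
    IsPhaseMixture y := by
  set h := CFC.abs y with hh
  have h0 : 0 ≤ h := CFC.abs_nonneg y
  have hsa : IsSelfAdjoint h := h0.isSelfAdjoint
  have hmul : h * h = star y * y := CFC.abs_mul_abs y
  have hu : IsUnit h := by
    have : IsUnit (h * h) := hmul ▸ hy.star.mul hy
    exact isUnit_of_mul_isUnit_left this
  obtain ⟨v, hv⟩ := hu
  have hnorm : ‖h‖ ≤ 1 := by
    have : ‖h‖ * ‖h‖ = ‖y‖ * ‖y‖ := by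
      rw [← CStarRing.norm_star_mul_self, ← CStarRing.norm_star_mul_self, hsa.star_eq, hmul]
    nlinarith [norm_nonneg h, norm_nonneg y]
  let u : Matrix κ κ ℂ := y * (v⁻¹ : (Matrix κ κ ℂ)ˣ)
  have hvs : star ((v⁻¹ : (Matrix κ κ ℂ)ˣ) : Matrix κ κ ℂ) = (v⁻¹ : (Matrix κ κ ℂ)ˣ) := by
    have : star v = v := Units.ext (by rw [Units.coe_star, hv, hsa.star_eq])
    rw [← Units.coe_star, star_inv, this]
  have huu : star u * u = 1 := by
    simp only [u, star_mul, hvs]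
    rw [mul_assoc, ← mul_assoc (star y), ← hmul, ← hv]
    simp
  have hum : u ∈ unitary (Matrix κ κ ℂ) := Matrix.mem_unitaryGroup_iff'.2 huu
  have hw := hsa.self_add_I_smul_cfcSqrt_sub_sq_mem_unitary h hnorm
  set w := h + Complex.I • CFC.sqrt (1 - h ^ 2) with hwdef
  have hsq : IsSelfAdjoint (CFC.sqrt (1 - h ^ 2)) := (CFC.sqrt_nonneg _).isSelfAdjoint
  have hws : star w = h - Complex.I • CFC.sqrt (1 - h ^ 2) := by
    rw [hwdef, star_add, star_smul, hsa.star_eq,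
      hsq.star_eq]
    simp [sub_eq_add_neg]
  have := (isPhaseMixture_of_mem_unitary (mul_mem hum hw)).midpoint
    (isPhaseMixture_of_mem_unitary (mul_mem hum (Unitary.star_mem hw)))
  convert this using 1
  have hadd : w + star w = (2 : ℂ) • h := by rw [hws, hwdef, two_smul]; abel
  rw [← mul_add, hadd, mul_smul_comm, smul_smul]
  simp [u, ← hv]

/-- Every strict contraction is a phase mixture: it is the midpoint of two invertible contractions,
and by polar decomposition each of those is the midpoint of two unitaries. -/
theorem isPhaseMixture_of_norm_lt_one {y : Matrix κ κ ℂ} (hy : ‖y‖ < 1) : IsPhaseMixture y := by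
  cases isEmpty_or_nonempty κ
  · exact ⟨Empty, inferInstance, nofun, nofun, nofun, nofun, Subsingleton.elim _ _,
      Subsingleton.elim _ _⟩
  have hfin : (spectrum ℂ y).Finite := Matrix.finite_spectrum y
  have hinj : Function.Injective (fun e : ℝ => (e : ℂ)) := Complex.ofReal_injective
  -- Both `y - e` and `y + e` must be invertible, so `e` avoids the finite spectrum up to sign; `0 <
  -- e < 1 - ‖y‖` keeps both contractive.
  have hbad : ((fun e : ℝ => (e : ℂ)) ⁻¹' spectrum ℂ y ∪
      (fun e : ℝ => (-e : ℂ)) ⁻¹' spectrum ℂ y).Finite :=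
    (hfin.preimage hinj.injOn).union
      (hfin.preimage (fun a _ b _ h => hinj (neg_injective h)))
  obtain ⟨e, he, hne⟩ := ((Set.Ioo_infinite (sub_pos.2 hy)).sdiff hbad).nonempty
  simp only [Set.mem_union, Set.mem_preimage, not_or, spectrum.mem_iff, not_not] at hne
  obtain ⟨h1, h2⟩ := hne
  have hen : ‖algebraMap ℂ (Matrix κ κ ℂ) (e : ℂ)‖ = e := by
    rw [norm_algebraMap', Complex.norm_real, Real.norm_of_nonneg he.1.le]
  have ha : IsPhaseMixture (y - algebraMap ℂ _ (e : ℂ)) := by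
    refine isPhaseMixture_of_isUnit ?_ ((norm_sub_le _ _).trans ?_)
    · rw [← neg_sub]; exact h1.neg
    · rw [hen]; linarith [he.2]
  have hb : IsPhaseMixture (y + algebraMap ℂ _ (e : ℂ)) := by
    refine isPhaseMixture_of_isUnit ?_ ((norm_add_le _ _).trans ?_)
    · rw [map_neg] at h2
      have := h2.neg
      rwa [neg_sub, sub_neg_eq_add] at this
    · rw [hen]; linarith [he.2]
  convert ha.midpoint hb using 1
  rw [sub_add_add_cancel, ← two_smul ℂ y, smul_smul]
  norm_num

end PhaseMixture

/-! ### The separable cone -/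

/-- The cone generated by the elementary tensors of positive semidefinite matrices. -/
def sepCone (ι κ : Type) : AddSubmonoid (Matrix (ι × κ) (ι × κ) ℂ) :=
  AddSubmonoid.closure {Z | ∃ (P : Matrix ι ι ℂ) (Q : Matrix κ κ ℂ),
    P.PosSemidef ∧ Q.PosSemidef ∧ Z = P ⊗ₖ Q}

section SepCone

variable {ι κ : Type}

theorem kronecker_mem_sepCone {P : Matrix ι ι ℂ} {Q : Matrix κ κ ℂ} (hP : P.PosSemidef)
    (hQ : Q.PosSemidef) : P ⊗ₖ Q ∈ sepCone ι κ :=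
  AddSubmonoid.subset_closure ⟨P, Q, hP, hQ, rfl⟩

theorem smul_mem_sepCone {c : ℂ} (hc : 0 ≤ c) {X : Matrix (ι × κ) (ι × κ) ℂ}
    (hX : X ∈ sepCone ι κ) : c • X ∈ sepCone ι κ := by
  induction hX using AddSubmonoid.closure_induction with
  | mem X h =>
    obtain ⟨P, Q, hP, hQ, rfl⟩ := h
    rw [← Matrix.smul_kronecker]
    exact kronecker_mem_sepCone (hP.smul hc) hQ
  | zero => simp
  | add X Y _ _ hX hY => rw [smul_add]; exact add_mem hX hY

theorem submatrix_swap_mem_sepCone {X : Matrix (ι × κ) (ι × κ) ℂ} (hX : X ∈ sepCone ι κ) :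
    X.submatrix Prod.swap Prod.swap ∈ sepCone κ ι := by
  induction hX using AddSubmonoid.closure_induction with
  | mem X h =>
    obtain ⟨P, Q, hP, hQ, rfl⟩ := h
    convert kronecker_mem_sepCone hQ hP using 1
    ext ⟨a, b⟩ ⟨c, d⟩
    simp [mul_comm]
  | zero => simp
  | add X Y _ _ hX hY => exact add_mem hX hY

theorem isSeparableMat_of_mem_sepCone {n m : ℕ} {X : BipartiteMat n m}
    (hX : X ∈ sepCone (Fin n) (Fin m)) : IsSeparableMat X := by
  induction hX using AddSubmonoid.closure_induction with
  | mem X h =>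
    obtain ⟨P, Q, hP, hQ, rfl⟩ := h
    exact ⟨1, fun _ => P, fun _ => Q, fun _ => hP, fun _ => hQ, by simp⟩
  | zero => exact ⟨0, nofun, nofun, nofun, nofun, by simp⟩
  | add X Y _ _ hX hY =>
    obtain ⟨N, P, Q, hP, hQ, rfl⟩ := hX
    obtain ⟨N', P', Q', hP', hQ', rfl⟩ := hY
    refine ⟨N + N', Fin.append P P', Fin.append Q Q', ?_, ?_, ?_⟩
    · exact fun i => Fin.addCases (by simpa using hP) (by simpa using hP') i
    · exact fun i => Fin.addCases (by simpa using hQ) (by simpa using hQ') i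
    · simp [Fin.sum_univ_add]

variable [Fintype ι] [DecidableEq ι] [Fintype κ] [DecidableEq κ]

/-- A Hermitian matrix whose blocks are strict contractions becomes separable after adding
the number of blocks per row. -/
theorem card_smul_one_add_mem_sepCone {y : Matrix (ι × κ) (ι × κ) ℂ} (hy : y.IsHermitian)
    (hb : ∀ i j, ‖y.submatrix (fun p : κ => (i, p)) (fun p => (j, p))‖ < 1) :
    (Fintype.card ι : ℂ) • 1 + y ∈ sepCone ι κ := by
  choose T hT c P hc hP h1 hs using fun i j => isPhaseMixture_of_norm_lt_one (hb i j)
  have hhalf : (0 : ℂ) ≤ 1 / 2 := by simp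
  -- The conjugate on `c` makes the `(i, j)` entry of `v v*` equal to `c`. For `i = j` the
  -- contributions add up, so no case split is needed.
  let v : ∀ i j, T i j → ι → ℂ := fun i j t => Pi.single i 1 + star (c i j t) • Pi.single j 1
  have key : (Fintype.card ι : ℂ) • 1 + y = (1 / 2 : ℂ) • ∑ i, ∑ j, ∑ t,
      Matrix.vecMulVec (v i j t) (star (v i j t)) ⊗ₖ P i j t := by
    ext ⟨a, p⟩ ⟨b, q⟩
    have e1 : ∀ i j, ∑ t, P i j t p q = (1 : Matrix κ κ ℂ) p q := fun i j => by
      rw [← h1 i j, Matrix.sum_apply]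
    have e2 : ∀ i j, ∑ t, c i j t * P i j t p q = y (i, p) (j, q) := fun i j => by
      have := congrFun (congrFun (hs i j) p) q
      simpa [Matrix.sum_apply] using this
    -- The conjugate coefficients produce the adjoint of the block `(i, j)`, which is the block `(j,
    -- i)` because `y` is Hermitian.
    have e3 : ∀ i j, ∑ t, star (c i j t) * P i j t p q = y (j, p) (i, q) := fun i j => by
      have := congrArg star (congrFun (congrFun (hs i j) q) p)
      rw [Matrix.submatrix_apply, hy.apply] at this
      rw [← this, Matrix.sum_apply, star_sum]
      refine Finset.sum_congr rfl fun t _ => ?_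
      rw [Matrix.smul_apply, smul_eq_mul, star_mul', (hP i j t).1.apply]
    let δ : ι → ι → ℂ := fun i a => (Pi.single i 1 : ι → ℂ) a
    have hδ : ∀ i a, star (δ i a) = δ i a := fun i a => by
      by_cases h : a = i
      · subst h; simp [δ]
      · simp [δ, Pi.single_apply, h]
    have e4 : ∀ i j, ∑ t, (Matrix.vecMulVec (v i j t) (star (v i j t)) ⊗ₖ P i j t) (a, p) (b, q) =
        (δ i a * δ i b + δ j a * δ j b) * (1 : Matrix κ κ ℂ) p q
          + δ i a * δ j b * y (i, p) (j, q) + δ j a * δ i b * y (j, p) (i, q) := fun i j => by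
      rw [← e1 i j, ← e2 i j, ← e3 i j, Finset.mul_sum, Finset.mul_sum, Finset.mul_sum,
        ← Finset.sum_add_distrib, ← Finset.sum_add_distrib]
      refine Finset.sum_congr rfl fun t _ => ?_
      have hct : star (c i j t) * c i j t = 1 := by
        have := Complex.conj_mul' (c i j t)
        rw [hc] at this
        simpa using this
      have e5 : (Matrix.vecMulVec (v i j t) (star (v i j t)) ⊗ₖ P i j t) (a, p) (b, q) =
          (δ i a + star (c i j t) * δ j a) * (δ i b + c i j t * δ j b) * P i j t p q := by
        rw [Matrix.kronecker_apply, Matrix.vecMulVec_apply, Pi.star_apply]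
        simp only [v, Pi.add_apply, Pi.smul_apply, smul_eq_mul, star_add, star_mul', star_star]
        change (δ i a + star (c i j t) * δ j a) * (star (δ i b) + c i j t * star (δ j b)) * _ = _
        rw [hδ, hδ]
      rw [e5]
      linear_combination δ j a * δ j b * P i j t p q * hct
    simp only [Matrix.smul_apply, Matrix.sum_apply, Matrix.add_apply, e4]
    have hsum : ∀ (f : ι → ℂ) a, ∑ i, δ i a * f i = f a := fun f a => by
      simp [δ, Pi.single_apply]
    have hone : (1 : Matrix (ι × κ) (ι × κ) ℂ) (a, p) (b, q)
        = (1 : Matrix ι ι ℂ) a b * (1 : Matrix κ κ ℂ) p q := by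
      rw [← Matrix.one_kronecker_one, Matrix.kronecker_apply]
    have hd : ∑ i, δ i a * δ i b = (1 : Matrix ι ι ℂ) a b := by
      rw [hsum (fun i => δ i b)]
      simp [δ, Pi.single_apply, Matrix.one_apply, eq_comm]
    have s1 : ∑ i, ∑ j, (δ i a * δ i b + δ j a * δ j b) * (1 : Matrix κ κ ℂ) p q
        = 2 * Fintype.card ι * (1 : Matrix (ι × κ) (ι × κ) ℂ) (a, p) (b, q) := by
      simp only [← Finset.sum_mul, Finset.sum_add_distrib, Finset.sum_const, hd, hone]
      simp only [Finset.card_univ, nsmul_eq_mul]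
      simp only [mul_assoc, ← Finset.mul_sum, hd]
      ring
    have s2 : ∑ i, ∑ j, δ i a * δ j b * y (i, p) (j, q) = y (a, p) (b, q) := by
      simp only [mul_assoc, ← Finset.mul_sum]
      rw [hsum (fun i => ∑ j, δ j b * y (i, p) (j, q)), hsum (fun j => y (a, p) (j, q))]
    have s3 : ∑ i, ∑ j, δ j a * δ i b * y (j, p) (i, q) = y (a, p) (b, q) := by
      rw [Finset.sum_comm]; exact s2
    simp only [Finset.sum_add_distrib] at s1 ⊢
    simp only [s1, s2, s3, smul_eq_mul]
    ring
  rw [key]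
  refine smul_mem_sepCone hhalf (sum_mem fun i _ => sum_mem fun j _ => sum_mem fun t _ => ?_)
  exact kronecker_mem_sepCone (Matrix.posSemidef_vecMulVec_self_star _) (hP i j t)

end SepCone

/-! ### Norms of submatrices and block matrices -/

theorem norm_le_of_conjTranspose_mul_self_le {ι κ : Type} [Fintype ι] [Fintype κ]
    [DecidableEq κ] {c : ℝ} (hc : 0 ≤ c) {A : Matrix ι κ ℂ}
    (h : Aᴴ * A ≤ algebraMap ℝ _ (c * c)) : ‖A‖ ≤ c := by
  have h0 : 0 ≤ Aᴴ * A := (Matrix.posSemidef_conjTranspose_mul_self A).nonneg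
  have := (CStarAlgebra.norm_le_iff_le_algebraMap _ (mul_nonneg hc hc) h0).2 h
  rw [Matrix.l2_opNorm_conjTranspose_mul_self] at this
  exact abs_le_of_sq_le_sq' (by nlinarith) hc |>.2

theorem norm_le_of_conjTranspose_mul_self_eq {ι κ : Type} [Fintype ι]
    [Fintype κ] [DecidableEq κ] {c : ℝ} (hc : 0 ≤ c) {A : Matrix ι κ ℂ}
    (h : Aᴴ * A = algebraMap ℝ _ (c * c)) : ‖A‖ ≤ c :=
  norm_le_of_conjTranspose_mul_self_le hc h.le

theorem conjTranspose_mul_self_le_one {ι κ : Type} [Fintype ι] [Fintype κ] [DecidableEq κ]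
    {A : Matrix ι κ ℂ} (h : ‖A‖ ≤ 1) : Aᴴ * A ≤ 1 := by
  have h0 : 0 ≤ Aᴴ * A := (Matrix.posSemidef_conjTranspose_mul_self A).nonneg
  rw [← CStarAlgebra.norm_le_one_iff_of_nonneg _ h0, Matrix.l2_opNorm_conjTranspose_mul_self]
  exact mul_le_one₀ h (norm_nonneg _) h

theorem norm_one_matrix_le_one {κ : Type} [Fintype κ] [DecidableEq κ] :
    ‖(1 : Matrix κ κ ℂ)‖ ≤ 1 := by
  rw [← Matrix.diagonal_one, Matrix.l2_opNorm_diagonal]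
  exact (pi_norm_le_iff_of_nonneg zero_le_one).2 fun _ => by simp

section Norms

variable {ι κ : Type} [Fintype ι] [DecidableEq ι] [Fintype κ] [DecidableEq κ]

theorem norm_submatrix_le {ι' κ' : Type} [Fintype ι'] [DecidableEq ι'] [Fintype κ']
    [DecidableEq κ'] (A : Matrix ι κ ℂ) {f : ι' → ι} {g : κ' → κ} (hf : f.Injective)
    (hg : g.Injective) : ‖A.submatrix f g‖ ≤ ‖A‖ := by
  have aux : ∀ {α β : Type} [Fintype α] [DecidableEq α] [Fintype β] [DecidableEq β] {h : α → β},
      h.Injective → ‖(1 : Matrix β β ℂ).submatrix id h‖ ≤ 1 := by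
    -- Selecting columns of the identity along an injection gives an isometry.
    intro α β _ _ _ _ h hh
    refine norm_le_of_conjTranspose_mul_self_eq zero_le_one ?_
    ext a b
    simp [Matrix.mul_apply, Matrix.one_apply, hh.eq_iff, Algebra.algebraMap_eq_smul_one]
  have h1 : A.submatrix f g = ((1 : Matrix ι ι ℂ).submatrix id f)ᴴ *
      (A * (1 : Matrix κ κ ℂ).submatrix id g) := by
    ext a b
    simp [Matrix.mul_apply, Matrix.one_apply]
  rw [h1]
  calc _ ≤ ‖((1 : Matrix ι ι ℂ).submatrix id f)ᴴ‖ * (‖A‖ * ‖(1 : Matrix κ κ ℂ).submatrix id g‖) :=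
        (Matrix.l2_opNorm_mul _ _).trans
          (mul_le_mul_of_nonneg_left (Matrix.l2_opNorm_mul _ _) (norm_nonneg _))
    _ ≤ 1 * (‖A‖ * 1) := by
        rw [Matrix.l2_opNorm_conjTranspose]
        gcongr
        · exact aux hf
        · exact aux hg
    _ = ‖A‖ := by ring

theorem posSemidef_fromBlocks_diagonal {A : Matrix ι ι ℂ} {D : Matrix κ κ ℂ}
    (hA : A.PosSemidef) (hD : D.PosSemidef) : (Matrix.fromBlocks A 0 0 D).PosSemidef := by
  obtain ⟨B, rfl⟩ := CStarAlgebra.nonneg_iff_eq_star_mul_self.1 hA.nonneg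
  obtain ⟨C, rfl⟩ := CStarAlgebra.nonneg_iff_eq_star_mul_self.1 hD.nonneg
  convert Matrix.posSemidef_conjTranspose_mul_self (Matrix.fromBlocks B 0 0 C) using 1
  simp [Matrix.star_eq_conjTranspose, Matrix.fromBlocks_conjTranspose, Matrix.fromBlocks_multiply]

/-- For this block matrix `M`, `Mᴴ * M` is block diagonal with blocks `Cᴴ * C` and `Bᴴ * B`, so `max
‖B‖ ‖C‖` bounds the norm. -/
theorem norm_fromBlocks_antidiagonal_lt_one {B : Matrix ι κ ℂ} {C : Matrix κ ι ℂ} (hB : ‖B‖ < 1)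
    (hC : ‖C‖ < 1) : ‖Matrix.fromBlocks 0 B C 0‖ < 1 := by
  have aux : ∀ {α β : Type} [Fintype α] [DecidableEq α] [Fintype β] [DecidableEq β]
      {D : Matrix α β ℂ} {c : ℝ}, ‖D‖ ≤ c → (algebraMap ℝ (Matrix β β ℂ) (c * c) - Dᴴ * D).PosSemidef := by
    intro α β _ _ _ _ D c h
    have h0 : 0 ≤ Dᴴ * D := (Matrix.posSemidef_conjTranspose_mul_self D).nonneg
    have hc := (norm_nonneg D).trans h
    rw [← Matrix.nonneg_iff_posSemidef, sub_nonneg,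
      ← CStarAlgebra.norm_le_iff_le_algebraMap _ (mul_nonneg hc hc) h0,
      Matrix.l2_opNorm_conjTranspose_mul_self]
    exact mul_le_mul h h (norm_nonneg _) hc
  refine lt_of_le_of_lt ?_ (max_lt hB hC)
  set c := max ‖B‖ ‖C‖
  refine norm_le_of_conjTranspose_mul_self_le ((norm_nonneg B).trans (le_max_left _ _)) ?_
  rw [Matrix.le_iff]
  have h1 := aux (le_max_right ‖B‖ ‖C‖)
  have h2 := aux (le_max_left ‖B‖ ‖C‖)
  have : algebraMap ℝ (Matrix (ι ⊕ κ) (ι ⊕ κ) ℂ) (c * c) -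
      (Matrix.fromBlocks 0 B C 0)ᴴ * Matrix.fromBlocks 0 B C 0 =
      Matrix.fromBlocks (algebraMap ℝ (Matrix ι ι ℂ) (c * c) - Cᴴ * C) 0 0
        (algebraMap ℝ (Matrix κ κ ℂ) (c * c) - Bᴴ * B) := by
    rw [Matrix.fromBlocks_conjTranspose, Matrix.fromBlocks_multiply]
    simp only [Algebra.algebraMap_eq_smul_one, ← Matrix.fromBlocks_one, Matrix.fromBlocks_smul]
    ext (a | a) (b | b) <;> simp
  rw [this]
  exact posSemidef_fromBlocks_diagonal h1 h2

/-- If the block matrix with diagonal blocks `c • 1` is positive semidefinite, then the norm of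
its off-diagonal block is at most `c`. -/
theorem norm_le_of_posSemidef_fromBlocks {c : ℝ} (hc : 0 < c) {B C : Matrix ι ι ℂ}
    (h : (Matrix.fromBlocks ((c : ℂ) • 1) B C ((c : ℂ) • 1)).PosSemidef) : ‖B‖ ≤ c := by
  have hC : C = Bᴴ := by
    have := (Matrix.isHermitian_fromBlocks_iff.1 h.1).2.1
    exact this.symm
  subst hC
  have hc' : (c : ℂ) ≠ 0 := by exact_mod_cast hc.ne'
  have hpd : ((c : ℂ) • (1 : Matrix ι ι ℂ)).PosDef :=
    Matrix.PosDef.one.smul (by exact_mod_cast hc)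
  have hinv : ((c : ℂ) • (1 : Matrix ι ι ℂ))⁻¹ = (c : ℂ)⁻¹ • 1 :=
    Matrix.inv_eq_left_inv (by
      rw [smul_mul_smul_comm, inv_mul_cancel₀ hc', one_smul, one_mul])
  let _ : Invertible ((c : ℂ) • (1 : Matrix ι ι ℂ)) := hpd.isUnit.invertible
  -- The Schur complement of the corner `c • 1` is `c • 1 - c⁻¹ • Bᴴ * B`.
  rw [Matrix.PosDef.fromBlocks₁₁ _ _ hpd, hinv] at h
  refine norm_le_of_conjTranspose_mul_self_le hc.le ?_
  rw [Matrix.le_iff]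
  have e : algebraMap ℝ (Matrix ι ι ℂ) (c * c) - Bᴴ * B =
      (c : ℂ) • ((c : ℂ) • 1 - Bᴴ * ((c : ℂ)⁻¹ • 1) * B) := by
    rw [smul_sub, Matrix.mul_smul, Matrix.smul_mul, smul_smul, smul_smul, mul_inv_cancel₀ hc',
      one_smul, Matrix.mul_one, Algebra.algebraMap_eq_smul_one]
    congr 1
    ext a b
    simp [Complex.real_smul]
  rw [e]
  exact h.smul (show (0 : ℂ) ≤ c by exact_mod_cast hc.le)

end Norms

/-! ### Amplifications and the bound by the size of the domain -/

section Amplification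

variable {ι : Type} {n m : ℕ}

/-- The amplification `Id ⊗ Φ` over an arbitrary index type. -/
def ampl (ι : Type) (Φ : MatAlg n →ₗ[ℂ] MatAlg m) :
    Matrix (ι × Fin n) (ι × Fin n) ℂ →ₗ[ℂ] Matrix (ι × Fin m) (ι × Fin m) ℂ where
  toFun X := .of fun a b => Φ (X.submatrix (fun p => (a.1, p)) (fun p => (b.1, p))) a.2 b.2
  map_add' X Y := by ext a b; simp [Matrix.submatrix_add]
  map_smul' c X := by ext a b; simp [Matrix.submatrix_smul]

theorem ampl_apply (Φ : MatAlg n →ₗ[ℂ] MatAlg m) (X : Matrix (ι × Fin n) (ι × Fin n) ℂ)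
    (a b : ι × Fin m) : ampl ι Φ X a b =
      Φ (X.submatrix (fun p => (a.1, p)) (fun p => (b.1, p))) a.2 b.2 := rfl

theorem amplify_eq_ampl (k : ℕ) (Φ : MatAlg n →ₗ[ℂ] MatAlg m) :
    amplify k Φ = ampl (Fin k) Φ := rfl

theorem ampl_kronecker (Φ : MatAlg n →ₗ[ℂ] MatAlg m) (P : Matrix ι ι ℂ) (Q : MatAlg n) :
    ampl ι Φ (P ⊗ₖ Q) = P ⊗ₖ Φ Q := by
  ext a b
  have : (P ⊗ₖ Q).submatrix (fun p => (a.1, p)) (fun p => (b.1, p)) = P a.1 b.1 • Q := rfl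
  rw [ampl_apply, this, map_smul]
  rfl

theorem map_posSemidef (Φ : MatAlg n →ₚ[ℂ] MatAlg m) {Q : MatAlg n} (hQ : Q.PosSemidef) :
    (Φ Q).PosSemidef :=
  Matrix.nonneg_iff_posSemidef.1 (Φ.map_nonneg hQ.nonneg)

variable [Fintype ι]

/-- On separable elements positivity of `Φ` replaces complete positivity: `P ⊗ Q` goes to `P ⊗ Φ Q`,
again a tensor product of positive matrices. -/
theorem posSemidef_ampl_of_mem_sepCone (Φ : MatAlg n →ₚ[ℂ] MatAlg m)
    {X : Matrix (ι × Fin n) (ι × Fin n) ℂ} (hX : X ∈ sepCone ι (Fin n)) :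
    (ampl ι Φ.toLinearMap X).PosSemidef := by
  induction hX using AddSubmonoid.closure_induction with
  | mem X h =>
    obtain ⟨P, Q, hP, hQ, rfl⟩ := h
    rw [ampl_kronecker]
    exact hP.kronecker (map_posSemidef Φ hQ)
  | zero => rw [map_zero]; exact Matrix.PosSemidef.zero
  | add X Y _ _ hX hY => rw [map_add]; exact hX.add hY

end Amplification

/-- Testing on the open unit ball is enough, which is why phase mixtures are needed for strict
contractions only. -/
theorem mapNorm_le {ι κ : Type} [Fintype ι] [DecidableEq ι] [Fintype κ] [DecidableEq κ]
    {Φ : Matrix ι ι ℂ →ₗ[ℂ] Matrix κ κ ℂ} {C : ℝ}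
    (h : ∀ X, ‖X‖ < 1 → ‖Φ X‖ ≤ C) : mapNorm Φ ≤ C := by
  rw [mapNorm, ← ContinuousLinearMap.sSup_unit_ball_eq_norm]
  refine csSup_le ((Metric.nonempty_ball.2 zero_lt_one).image _) ?_
  rintro _ ⟨X, hX, rfl⟩
  exact h X (by simpa using hX)

theorem norm_apply_le_mapNorm {ι κ : Type} [Fintype ι] [DecidableEq ι] [Fintype κ] [DecidableEq κ]
    (Φ : Matrix ι ι ℂ →ₗ[ℂ] Matrix κ κ ℂ) (X : Matrix ι ι ℂ) : ‖Φ X‖ ≤ mapNorm Φ * ‖X‖ :=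
  (LinearMap.toContinuousLinearMap Φ).le_opNorm X

/-- Unital positive maps are contractive (Russo–Dye). -/
theorem mapNorm_le_one_of_unital {n m : ℕ} (Φ : MatAlg n →ₚ[ℂ] MatAlg m) (h : Φ 1 = 1) :
    mapNorm Φ.toLinearMap ≤ 1 := by
  refine mapNorm_le fun X hX => ?_
  obtain ⟨T, _, c, P, hc, hP, h1, hs⟩ := isPhaseMixture_of_norm_lt_one hX
  refine norm_le_of_posSemidef_fromBlocks (C := ∑ t, star (c t) • Φ (P t)) zero_lt_one ?_
  -- Each `P t` contributes the positive matrix with rows `(Φ P, c • Φ P)` and `(star c • Φ P, Φ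
  -- P)`, a congruence of `Φ P`; the diagonal blocks sum to `Φ 1 = 1`.
  have e : Matrix.fromBlocks (((1 : ℝ) : ℂ) • 1) (Φ X) (∑ t, star (c t) • Φ (P t))
      (((1 : ℝ) : ℂ) • 1) = ∑ t, (Matrix.fromCols 1 (c t • (1 : MatAlg m)))ᴴ * Φ (P t) *
        (Matrix.fromCols 1 (c t • (1 : MatAlg m))) := by
    have e1 : ∀ t, (Matrix.fromCols 1 (c t • (1 : MatAlg m)))ᴴ * Φ (P t) *
        (Matrix.fromCols 1 (c t • (1 : MatAlg m))) =
        Matrix.fromBlocks (Φ (P t)) (c t • Φ (P t)) (star (c t) • Φ (P t)) (Φ (P t)) := fun t => by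
      have hct : star (c t) * c t = 1 := by
        have := Complex.conj_mul' (c t)
        rw [hc] at this
        simpa using this
      rw [Matrix.conjTranspose_fromCols_eq_fromRows_conjTranspose, Matrix.fromRows_mul,
        Matrix.fromRows_mul_fromCols]
      simp only [Matrix.conjTranspose_smul, Matrix.conjTranspose_one, Matrix.one_mul,
        Matrix.mul_one, Matrix.smul_mul, Matrix.mul_smul, smul_smul]
      rw [mul_comm (c t), hct, one_smul]
    have e2 : ∀ f g : T → MatAlg m, ∑ t, Matrix.fromBlocks (Φ (P t)) (f t) (g t) (Φ (P t)) =
        Matrix.fromBlocks (∑ t, Φ (P t)) (∑ t, f t) (∑ t, g t) (∑ t, Φ (P t)) := fun f g => by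
      ext (a | a) (b | b) <;> simp [Matrix.sum_apply]
    simp only [e1]
    rw [e2, ← map_sum, h1, h, ← hs, map_sum]
    simp
  rw [Φ.coe_toLinearMap, e]
  exact Matrix.posSemidef_sum _ fun t _ => (map_posSemidef Φ (hP t)).conjTranspose_mul_mul_same _

/-- Amplifications of a contractive positive map on `M_n` have norm at most `n`. -/
theorem mapNorm_amplify_le_domain {n m : ℕ} (hn : 1 ≤ n) (k : ℕ) (Φ : MatAlg n →ₚ[ℂ] MatAlg m)
    (h : mapNorm Φ.toLinearMap ≤ 1) : mapNorm (amplify k Φ.toLinearMap) ≤ n := by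
  refine mapNorm_le fun X hX => ?_
  rw [amplify_eq_ampl]
  have hΦ1 : (1 - Φ 1).PosSemidef := by
    rw [← Matrix.le_iff, ← CStarAlgebra.norm_le_one_iff_of_nonneg _ (Φ.map_nonneg zero_le_one)]
    exact (norm_apply_le_mapNorm Φ.toLinearMap 1).trans (mul_le_one₀ h (norm_nonneg _) norm_one_matrix_le_one)
  -- Self-adjoint dilation of `X`, with `M_2` absorbed into the first factor. The swap below makes
  -- `Fin n` the block index, so the constant is `n`, independent of `k`.
  let y : Matrix ((Fin k ⊕ Fin k) × Fin n) ((Fin k ⊕ Fin k) × Fin n) ℂ := .of fun a b =>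
    Matrix.fromBlocks 0 (X.submatrix (fun s => (s, a.2)) (fun s => (s, b.2)))
      (Xᴴ.submatrix (fun s => (s, a.2)) (fun s => (s, b.2))) 0 a.1 b.1
  have hy : y.IsHermitian := by
    ext ⟨a | a, p⟩ ⟨b | b, q⟩ <;> simp [y]
  have hsep := submatrix_swap_mem_sepCone (card_smul_one_add_mem_sepCone
    (y := y.submatrix Prod.swap Prod.swap) (hy.submatrix _) fun p q => by
      refine norm_fromBlocks_antidiagonal_lt_one
        (B := X.submatrix (fun s => (s, p)) (fun s => (s, q)))
        (C := Xᴴ.submatrix (fun s => (s, p)) (fun s => (s, q))) ?_ ?_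
      · exact (norm_submatrix_le _ (Prod.mk_left_injective _) (Prod.mk_left_injective _)).trans_lt hX
      · refine (norm_submatrix_le _ (Prod.mk_left_injective _)
          (Prod.mk_left_injective _)).trans_lt ?_
        rwa [Matrix.l2_opNorm_conjTranspose])
  have hZ : ((Fintype.card (Fin n) : ℂ) • 1 + y.submatrix Prod.swap Prod.swap).submatrix
      Prod.swap Prod.swap = (n : ℂ) • ((1 : Matrix (Fin k ⊕ Fin k) (Fin k ⊕ Fin k) ℂ) ⊗ₖ
        (1 : MatAlg n)) + y := by
    rw [Fintype.card_fin, Matrix.one_kronecker_one]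
    ext a b
    simp [Matrix.one_apply]
  rw [hZ] at hsep
  have hpos := posSemidef_ampl_of_mem_sepCone Φ hsep
  rw [map_add, map_smul, ampl_kronecker] at hpos
  -- Adding `n • 1 ⊗ (1 - Φ 1)` turns the diagonal part `n • 1 ⊗ Φ 1` into `n • 1`.
  have hpos1 : ((n : ℂ) • ((1 : Matrix (Fin k ⊕ Fin k) (Fin k ⊕ Fin k) ℂ) ⊗ₖ
      (1 - Φ 1))).PosSemidef :=
    (Matrix.PosSemidef.one.kronecker hΦ1).smul (Nat.cast_nonneg n)
  have hpos2 := (hpos.add hpos1).submatrix (Equiv.sumProdDistrib (Fin k) (Fin k) (Fin m)).symm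
  refine norm_le_of_posSemidef_fromBlocks (C := ampl (Fin k) Φ.toLinearMap Xᴴ)
    (Nat.cast_pos.2 hn) ?_
  convert hpos2 using 1
  have y1 : ∀ a b, y.submatrix (fun p => (Sum.inl a, p)) (fun p => (Sum.inl b, p)) = 0 :=
    fun _ _ => rfl
  have y2 : ∀ a b, y.submatrix (fun p => (Sum.inr a, p)) (fun p => (Sum.inr b, p)) = 0 :=
    fun _ _ => rfl
  have y3 : ∀ a b, y.submatrix (fun p => (Sum.inl a, p)) (fun p => (Sum.inr b, p)) =
    X.submatrix (fun p => (a, p)) (fun p => (b, p)) := fun _ _ => rfl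
  have y4 : ∀ a b, y.submatrix (fun p => (Sum.inr a, p)) (fun p => (Sum.inl b, p)) =
    Xᴴ.submatrix (fun p => (a, p)) (fun p => (b, p)) := fun _ _ => rfl
  ext (⟨a, p⟩ | ⟨a, p⟩) (⟨b, q⟩ | ⟨b, q⟩) <;>
    simp [ampl_apply, y1, y2, y3, y4, Matrix.one_apply]
  all_goals by_cases hab : a = b <;> by_cases hpq : p = q <;> simp [hab, hpq, mul_sub]

theorem sum_rotate {α β γ : Type} [Fintype α] [Fintype β] [Fintype γ] (f : α → β → γ → ℂ) :
    ∑ a, ∑ b, ∑ c, f a b c = ∑ c, ∑ a, ∑ b, f a b c := by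
  rw [Finset.sum_comm (γ := γ)]
  exact Finset.sum_congr rfl fun a _ => Finset.sum_comm

/-! ### The bound by the size of the codomain -/

section CodomainBound

variable {ι κ : Type} [Fintype ι] [DecidableEq ι] [Fintype κ] [DecidableEq κ]

theorem norm_le_of_sesquilinear_le {ι κ : Type} [Fintype ι] [Fintype κ] [DecidableEq κ]
    {A : Matrix ι κ ℂ} {c : ℝ} (hc : 0 ≤ c)
    (h : ∀ (z : ι → ℂ) (x : κ → ℂ), ∑ a, ‖z a‖ ^ 2 = 1 → ∑ b, ‖x b‖ ^ 2 = 1 →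
      ‖∑ a, ∑ b, star (z a) * A a b * x b‖ ≤ c) : ‖A‖ ≤ c := by
  rw [Matrix.l2_opNorm_def]
  refine ContinuousLinearMap.opNorm_le_of_re_inner_le hc fun x z hx hz => ?_
  refine (Complex.re_le_norm _).trans ?_
  rw [← inner_conj_symm, Complex.norm_conj]
  have hx' : ∑ b, ‖x b‖ ^ 2 = 1 := by rw [← EuclideanSpace.norm_sq_eq, hx, one_pow]
  have hz' : ∑ a, ‖z a‖ ^ 2 = 1 := by rw [← EuclideanSpace.norm_sq_eq, hz, one_pow]
  refine le_of_eq_of_le (congrArg _ ?_) (h z x hz' hx')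
  simp [PiLp.inner_apply, Matrix.mulVec, dotProduct, Finset.mul_sum, mul_comm,
    mul_left_comm, mul_assoc]

theorem norm_entry_le_norm (A : Matrix ι κ ℂ) (a : ι) (b : κ) : ‖A a b‖ ≤ ‖A‖ := by
  have h1 : A.submatrix (fun _ : Unit => a) (fun _ : Unit => b) =
      Matrix.diagonal fun _ => A a b := by
    ext; simp
  have h2 := norm_submatrix_le A (Function.injective_of_subsingleton fun _ : Unit => a)
    (Function.injective_of_subsingleton fun _ : Unit => b)
  rw [h1, Matrix.l2_opNorm_diagonal] at h2
  exact (norm_le_pi_norm (fun _ : Unit => A a b) ()).trans h2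

/-- Compressing the first tensor factor by two vectors is contractive up to their norms. -/
theorem norm_sum_smul_block_le (X : Matrix (ι × κ) (ι × κ) ℂ) (z x : ι → ℂ) :
    ‖∑ a, ∑ b, (star (z a) * x b) • X.submatrix (fun p => (a, p)) (fun p => (b, p))‖ ≤
      √(∑ a, ‖z a‖ ^ 2) * √(∑ a, ‖x a‖ ^ 2) * ‖X‖ := by
  -- `V z` is `z ⊗ 1`, so that `(V z)ᴴ * V z` is the scalar `∑ ‖z a‖²`.
  let V : (ι → ℂ) → Matrix (ι × κ) κ ℂ := fun z => .of fun a q => if a.2 = q then z a.1 else 0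
  have hV : ∀ z, ‖V z‖ ≤ √(∑ a, ‖z a‖ ^ 2) := fun z => by
    refine norm_le_of_conjTranspose_mul_self_eq (Real.sqrt_nonneg _) ?_
    rw [Real.mul_self_sqrt (Finset.sum_nonneg fun _ _ => by positivity)]
    ext p q
    rw [Algebra.algebraMap_eq_smul_one, Matrix.smul_apply]
    by_cases hpq : p = q
    · subst hpq
      simp [V, Matrix.mul_apply, Fintype.sum_prod_type, Complex.conj_mul']
    · simp [V, Matrix.mul_apply, Fintype.sum_prod_type, hpq, Ne.symm hpq]
  have e : ∑ a, ∑ b, (star (z a) * x b) • X.submatrix (fun p => (a, p)) (fun p => (b, p)) =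
      (V z)ᴴ * (X * V x) := by
    ext p q
    simp [V, Matrix.mul_apply, Matrix.sum_apply, Fintype.sum_prod_type, Finset.mul_sum,
      Finset.sum_mul, apply_ite, mul_comm, mul_left_comm, mul_assoc]
  rw [e]
  calc _ ≤ ‖(V z)ᴴ‖ * (‖X‖ * ‖V x‖) :=
        (Matrix.l2_opNorm_mul _ _).trans
          (mul_le_mul_of_nonneg_left (Matrix.l2_opNorm_mul _ _) (norm_nonneg _))
    _ ≤ √(∑ a, ‖z a‖ ^ 2) * (‖X‖ * √(∑ a, ‖x a‖ ^ 2)) := by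
        rw [Matrix.l2_opNorm_conjTranspose]
        gcongr
        · exact hV z
        · exact hV x
    _ = _ := by ring

end CodomainBound

/-- Amplifications of a contractive map into `M_m` have norm at most `m`. -/
theorem mapNorm_amplify_le_codomain {n m : ℕ} (k : ℕ) (Φ : MatAlg n →ₗ[ℂ] MatAlg m)
    (h : mapNorm Φ ≤ 1) : mapNorm (amplify k Φ) ≤ m := by
  refine mapNorm_le fun X hX => ?_
  rw [amplify_eq_ampl]
  refine norm_le_of_sesquilinear_le m.cast_nonneg fun z x hz hx => ?_
  let s : Fin m → ℝ := fun i => √(∑ a, ‖z (a, i)‖ ^ 2)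
  let t : Fin m → ℝ := fun j => √(∑ b, ‖x (b, j)‖ ^ 2)
  have hs : ∑ i, s i ^ 2 = 1 := by
    rw [← hz, Fintype.sum_prod_type, Finset.sum_comm]
    exact Finset.sum_congr rfl fun i _ => Real.sq_sqrt (Finset.sum_nonneg fun _ _ => by positivity)
  have ht : ∑ j, t j ^ 2 = 1 := by
    rw [← hx, Fintype.sum_prod_type, Finset.sum_comm]
    exact Finset.sum_congr rfl fun i _ => Real.sq_sqrt (Finset.sum_nonneg fun _ _ => by positivity)
  -- `Z i j` compresses `X` by the slices of `z` and `x` at coordinates `i` and `j` of `ℂ^m`. By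
  -- linearity `Φ` acts on these compressions directly, so no amplified norm enters.
  let Z : Fin m → Fin m → MatAlg n := fun i j => ∑ a, ∑ b,
    (star (z (a, i)) * x (b, j)) • X.submatrix (fun p => (a, p)) (fun p => (b, p))
  have e : ∑ a, ∑ b, star (z a) * ampl (Fin k) Φ X a b * x b = ∑ i, ∑ j, Φ (Z i j) i j := by
    simp only [Z, map_sum, map_smul, Matrix.sum_apply, Matrix.smul_apply, smul_eq_mul,
      Fintype.sum_prod_type, ampl_apply]
    rw [Finset.sum_comm]
    refine Finset.sum_congr rfl fun i _ => ?_
    rw [sum_rotate]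
    refine Finset.sum_congr rfl fun j _ => Finset.sum_congr rfl fun a _ =>
      Finset.sum_congr rfl fun b _ => by ring
  rw [e]
  -- AM-GM on `s i * t j`: since the `s i ^ 2` and the `t j ^ 2` each sum to `1`, the double sum of
  -- the right-hand sides is exactly `m`.
  have hZ : ∀ i j, ‖Φ (Z i j) i j‖ ≤ (s i ^ 2 + t j ^ 2) / 2 := fun i j => by
    have h1 := norm_sum_smul_block_le X (fun a => z (a, i)) (fun b => x (b, j))
    have h2 : 0 ≤ s i * t j := mul_nonneg (Real.sqrt_nonneg _) (Real.sqrt_nonneg _)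
    calc ‖Φ (Z i j) i j‖ ≤ ‖Φ (Z i j)‖ := norm_entry_le_norm _ _ _
      _ ≤ mapNorm Φ * ‖Z i j‖ := norm_apply_le_mapNorm _ _
      _ ≤ 1 * ‖Z i j‖ := by gcongr
      _ = ‖Z i j‖ := one_mul _
      _ ≤ s i * t j * ‖X‖ := h1
      _ ≤ s i * t j := mul_le_of_le_one_right h2 hX.le
      _ ≤ (s i ^ 2 + t j ^ 2) / 2 := by nlinarith [sq_nonneg (s i - t j)]
  calc ‖∑ i, ∑ j, Φ (Z i j) i j‖ ≤ ∑ i, ∑ j, (s i ^ 2 + t j ^ 2) / 2 :=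
        norm_sum_le_of_le _ fun i _ => norm_sum_le_of_le _ fun j _ => hZ i j
    _ = m := by
        simp only [← Finset.sum_div, Finset.sum_add_distrib, ht, Finset.sum_const,
          Finset.card_univ, Fintype.card_fin, ← Finset.smul_sum, hs]
        simp

/-! ### The separability radius -/

section Gamma

/-- The blocks of `-n • x` are strict contractions, so `n • 1 - n • x` is separable; dividing by `n`
gives the claim. -/
theorem one_sub_mem_sepCone_of_left {n m : ℕ} {r : ℝ} (hr : n * r < 1)
    {x : BipartiteMat n m} (hx : x.IsHermitian) (hn : 1 ≤ n) (hxr : ‖x‖ ≤ r) :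
    1 - x ∈ sepCone (Fin n) (Fin m) := by
  have hn0 : (n : ℂ) ≠ 0 := Nat.cast_ne_zero.2 (by omega)
  have h := card_smul_one_add_mem_sepCone (y := -((n : ℂ) • x))
    (hx.smul (by simp [IsSelfAdjoint])).neg fun i j => by
      refine (norm_submatrix_le _ (Prod.mk_right_injective _) (Prod.mk_right_injective _)).trans_lt
        (lt_of_le_of_lt ?_ hr)
      rw [norm_neg, norm_smul, Complex.norm_natCast]
      gcongr
  have := smul_mem_sepCone (c := (n : ℂ)⁻¹) (by simp) h
  rwa [Fintype.card_fin, smul_add, smul_neg, inv_smul_smul₀ hn0, inv_smul_smul₀ hn0,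
    ← sub_eq_add_neg] at this

theorem one_sub_mem_sepCone_of_right {n m : ℕ} {r : ℝ} (hr : m * r < 1)
    {x : BipartiteMat n m} (hx : x.IsHermitian) (hm : 1 ≤ m) (hxr : ‖x‖ ≤ r) :
    1 - x ∈ sepCone (Fin n) (Fin m) := by
  have h := submatrix_swap_mem_sepCone (one_sub_mem_sepCone_of_left hr
    (hx.submatrix Prod.swap) hm ((norm_submatrix_le x Prod.swap_injective
      Prod.swap_injective).trans hxr))
  convert h using 1
  ext ⟨a, p⟩ ⟨b, q⟩
  simp [Matrix.one_apply, and_comm]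

/-- The partial flip of `ℂ^n ⊗ ℂ^m`, exchanging `e_i ⊗ e_j` and `e_j ⊗ e_i`
for `i, j < min n m`. -/
def partialFlip (n m : ℕ) : BipartiteMat n m :=
  .of fun a b => if a.1.val = b.2.val ∧ a.2.val = b.1.val then 1 else 0

theorem isHermitian_partialFlip (n m : ℕ) : (partialFlip n m).IsHermitian := by
  ext a b
  simp only [partialFlip, Matrix.conjTranspose_apply, Matrix.of_apply]
  rw [apply_ite star, star_one, star_zero]
  congr 1
  exact propext ⟨fun h => ⟨h.2.symm, h.1.symm⟩, fun h => ⟨h.2.symm, h.1.symm⟩⟩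

theorem norm_partialFlip_le_one (n m : ℕ) : ‖partialFlip n m‖ ≤ 1 := by
  let i : Fin n → Fin (max n m) := Fin.castLE (le_max_left _ _)
  let j : Fin m → Fin (max n m) := Fin.castLE (le_max_right _ _)
  have hi : i.Injective := Fin.castLE_injective _
  have hj : j.Injective := Fin.castLE_injective _
  have e : partialFlip n m = (1 : Matrix (Fin (max n m) × Fin (max n m)) _ ℂ).submatrix
      (fun a => (j a.2, i a.1)) (fun a => (i a.1, j a.2)) := by
    ext a b
    simp [partialFlip, Matrix.one_apply, i, j, Fin.ext_iff, and_comm]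
  rw [e]
  refine (norm_submatrix_le _ ?_ (hi.prodMap hj)).trans norm_one_matrix_le_one
  exact (hj.prodMap hi).comp Prod.swap_injective

/-- The flip of the common `k × k` corner, `k = min n m`, is an entanglement witness: pairing with
it sends `P ⊗ Q` to the trace of the product of the corners of `P` and `Q`, which is nonnegative,
and `1 - r F` to `k - r k²`. -/
theorem le_inv_min_of_isSeparableMat {n m : ℕ} (hn : 1 ≤ n) (hm : 1 ≤ m) {r : ℝ}
    (h : IsSeparableMat (1 - (r : ℂ) • partialFlip n m)) : r * (min n m : ℕ) ≤ 1 := by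
  set k := min n m with hk
  have hk0 : (0 : ℝ) < k := Nat.cast_pos.2 (by omega)
  let i : Fin k → Fin n := Fin.castLE (min_le_left _ _)
  let j : Fin k → Fin m := Fin.castLE (min_le_right _ _)
  obtain ⟨N, P, Q, hP, hQ, e⟩ := h
  have key : (k : ℂ) - r * k * k = ∑ l, ((P l).submatrix i i * (Q l).submatrix j j).trace := by
    have : ∑ s, ∑ t, (1 - (r : ℂ) • partialFlip n m) (i s, j t) (i t, j s) =
        (k : ℂ) - r * k * k := by
      have ent : ∀ s t, (1 - (r : ℂ) • partialFlip n m) (i s, j t) (i t, j s) =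
          (if s = t then 1 else 0) - (r : ℂ) := fun s t => by
        have : (s = t ∧ t = s) = (s = t) := propext ⟨And.left, fun h => ⟨h, h.symm⟩⟩
        simp [partialFlip, i, j, Matrix.one_apply, this]
      simp only [ent, Finset.sum_sub_distrib, Finset.sum_ite_eq, Finset.mem_univ, if_true]
      simp
      ring
    rw [← this, e]
    simp only [Matrix.sum_apply, Matrix.trace, Matrix.diag, Matrix.mul_apply,
      Matrix.kronecker_apply, Matrix.submatrix_apply]
    exact sum_rotate _
  have hnonneg : (0 : ℂ) ≤ (k : ℂ) - r * k * k := by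
    rw [key]
    refine Finset.sum_nonneg fun l _ => ?_
    -- With the corner of `P l` written as `Bᴴ * B`, the trace becomes that of the positive matrix
    -- `B * Q * Bᴴ`, where `Q` is the corner of `Q l`.
    obtain ⟨B, hB⟩ := CStarAlgebra.nonneg_iff_eq_star_mul_self.1 ((hP l).submatrix i).nonneg
    rw [hB, Matrix.star_eq_conjTranspose, mul_assoc, Matrix.trace_mul_comm]
    exact (((hQ l).submatrix j).mul_mul_conjTranspose_same B).trace_nonneg
  have h2 : (0 : ℝ) ≤ k - r * k * k := by exact_mod_cast hnonneg
  have h3 : 0 ≤ (k : ℝ) * (1 - r * k) := by linarith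
  linarith [nonneg_of_mul_nonneg_right h3 hk0]

theorem gammaMat_eq {n m : ℕ} (hn : 1 ≤ n) (hm : 1 ≤ m) :
    gammaMat n m = 1 / ((min n m : ℕ) : ℝ≥0∞) := by
  have hk : ((min n m : ℕ) : ℝ≥0∞) ≠ 0 := Nat.cast_ne_zero.2 (by omega)
  have hk' : ((min n m : ℕ) : ℝ≥0∞) ≠ ∞ := ENNReal.natCast_ne_top _
  -- The lower bound only uses radii strictly below `1 / min n m`, which suffices for the supremum.
  refine le_antisymm (iSup₂_le fun r h => ?_) (ENNReal.le_of_forall_nnreal_lt fun r hr => ?_)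
  · have hsep := h ((r : ℂ) • partialFlip n m)
      ((isHermitian_partialFlip n m).smul (by simp [IsSelfAdjoint])) (by
        rw [norm_smul]
        simpa using mul_le_mul_of_nonneg_left (norm_partialFlip_le_one n m) r.2)
    rw [Matrix.one_kronecker_one] at hsep
    have := le_inv_min_of_isSeparableMat hn hm (r := r) hsep
    rw [ENNReal.le_div_iff_mul_le (.inl hk) (.inl hk')]
    have h' : r * (min n m : ℕ) ≤ 1 := by
      rwa [← NNReal.coe_le_coe, NNReal.coe_mul, NNReal.coe_natCast, NNReal.coe_one]
    rw [← ENNReal.coe_natCast, ← ENNReal.coe_mul, ← ENNReal.coe_one]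
    exact ENNReal.coe_le_coe.2 h'
  · rw [ENNReal.lt_div_iff_mul_lt (.inl hk) (.inl hk')] at hr
    have hr' : ((min n m : ℕ) : ℝ) * r < 1 := by
      have h' : r * (min n m : ℕ) < 1 := by
        rw [← ENNReal.coe_natCast, ← ENNReal.coe_mul, ← ENNReal.coe_one] at hr
        exact ENNReal.coe_lt_coe.1 hr
      rwa [← NNReal.coe_lt_coe, NNReal.coe_mul, NNReal.coe_natCast, NNReal.coe_one, mul_comm] at h'
    refine le_iSup₂_of_le r (fun x hx hxr => ?_) le_rfl
    rw [Matrix.one_kronecker_one]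
    refine isSeparableMat_of_mem_sepCone ?_
    rcases le_total n m with hnm | hnm
    · rw [min_eq_left hnm] at hr'
      exact one_sub_mem_sepCone_of_left hr' hx hn hxr
    · rw [min_eq_right hnm] at hr'
      exact one_sub_mem_sepCone_of_right hr' hx hm hxr

end Gamma

/-! ### A unital positive map of maximal cb norm -/

section Extremal

/-- The partial isometry `ℂ^m → ℂ^n` identifying the first `min n m` basis vectors. -/
def partialIsometry (n m : ℕ) : Matrix (Fin n) (Fin m) ℂ :=
  .of fun i j => if i.val = j.val then 1 else 0

theorem norm_partialIsometry_le_one (n m : ℕ) : ‖partialIsometry n m‖ ≤ 1 := by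
  have e : partialIsometry n m = (1 : MatAlg (max n m)).submatrix
      (Fin.castLE (le_max_left _ _)) (Fin.castLE (le_max_right _ _)) := by
    ext a b
    simp [partialIsometry, Matrix.one_apply, Fin.ext_iff]
  rw [e]
  exact (norm_submatrix_le _ (Fin.castLE_injective _) (Fin.castLE_injective _)).trans
    norm_one_matrix_le_one

theorem conjTranspose_partialIsometry_mul_mul_apply {n m : ℕ} (M : MatAlg n)
    (a b : Fin (min n m)) :
    ((partialIsometry n m)ᴴ * M * partialIsometry n m) (Fin.castLE (min_le_right _ _) a)
      (Fin.castLE (min_le_right _ _) b) =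
    M (Fin.castLE (min_le_left _ _) a) (Fin.castLE (min_le_left _ _) b) := by
  have h : ∀ (i : Fin n) (c : Fin (min n m)),
      (i.val = c.val) = (i = Fin.castLE (min_le_left n m) c) := fun i c => by
    rw [Fin.ext_iff, Fin.val_castLE]
  simp [partialIsometry, Matrix.mul_apply, h, apply_ite]

/-- The transposition, compressed to the common corner of `M_n` and `M_m` and completed to
a unital positive map. -/
noncomputable def cornerTranspose {n m : ℕ} (hn : 1 ≤ n) : MatAlg n →ₚ[ℂ] MatAlg m :=
  PositiveLinearMap.mk₀
    { toFun := fun x => (partialIsometry n m)ᴴ * xᵀ * partialIsometry n m +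
        x ⟨0, hn⟩ ⟨0, hn⟩ • (1 - (partialIsometry n m)ᴴ * partialIsometry n m)
      map_add' := fun x y => by
        rw [Matrix.transpose_add, Matrix.mul_add, Matrix.add_mul, Matrix.add_apply, add_smul]
        abel
      map_smul' := fun c x => by
        rw [Matrix.transpose_smul, Matrix.mul_smul, Matrix.smul_mul, Matrix.smul_apply, smul_assoc,
          RingHom.id_apply, smul_add] }
    fun x hx => by
      -- The first term is a compression of the transpose; the second is a nonnegative diagonal
      -- entry times the defect `1 - Vᴴ * V ≥ 0` of the partial isometry `V`. This defect restores
      -- unitality when `n < m`.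
      have hx := Matrix.nonneg_iff_posSemidef.1 hx
      refine Matrix.nonneg_iff_posSemidef.2 ((hx.transpose.conjTranspose_mul_mul_same _).add
        (Matrix.PosSemidef.smul ?_ hx.diag_nonneg))
      rw [← Matrix.le_iff]
      exact conjTranspose_mul_self_le_one (norm_partialIsometry_le_one n m)

theorem cornerTranspose_apply {n m : ℕ} (hn : 1 ≤ n) (x : MatAlg n) :
    cornerTranspose (m := m) hn x = (partialIsometry n m)ᴴ * xᵀ * partialIsometry n m +
      x ⟨0, hn⟩ ⟨0, hn⟩ • (1 - (partialIsometry n m)ᴴ * partialIsometry n m) := rfl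

theorem cornerTranspose_one {n m : ℕ} (hn : 1 ≤ n) : cornerTranspose (m := m) hn 1 = 1 := by
  simp [cornerTranspose_apply]

theorem cornerTranspose_corner {n m : ℕ} (hn : 1 ≤ n) (x : MatAlg n) (a b : Fin (min n m)) :
    cornerTranspose hn x (Fin.castLE (min_le_right n m) a) (Fin.castLE (min_le_right n m) b) =
      x (Fin.castLE (min_le_left _ _) b) (Fin.castLE (min_le_left _ _) a) := by
  have h := conjTranspose_partialIsometry_mul_mul_apply (m := m) (1 : MatAlg n) a b
  rw [Matrix.mul_one] at h
  rw [cornerTranspose_apply, Matrix.add_apply, conjTranspose_partialIsometry_mul_mul_apply,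
    Matrix.smul_apply, Matrix.sub_apply, h]
  simp [Matrix.one_apply]

/-- The all-ones matrix satisfies `Jᴴ * J = k • J`, so the C⋆-identity gives `‖J‖ = k` for `k > 0`.
-/
theorem card_le_norm_of_one (k : ℕ) :
    (k : ℝ) ≤ ‖(Matrix.of fun _ _ => 1 : MatAlg k)‖ := by
  rcases Nat.eq_zero_or_pos k with rfl | hk
  · simp
  set J : MatAlg k := Matrix.of fun _ _ => 1
  have hJ : Jᴴ * J = (k : ℂ) • J := by
    ext a b
    simp [J, Matrix.mul_apply]
  have h0 : J ≠ 0 := fun h => one_ne_zero (congrFun (congrFun h ⟨0, hk⟩) ⟨0, hk⟩)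
  have h1 := Matrix.l2_opNorm_conjTranspose_mul_self J
  rw [hJ, norm_smul, Complex.norm_natCast] at h1
  exact (mul_right_cancel₀ (norm_ne_zero_iff.2 h0) h1).le

/-- Block `(a, b)` of the flip is the matrix unit `E_ba`, which transposition turns into `E_ab`.
Restricted to the indices `(a, a)`, the image is the all-ones matrix of norm `min n m`, while the
flip has norm at most `1`. -/
theorem min_le_mapNorm_amplify_cornerTranspose {n m : ℕ} (hn : 1 ≤ n) :
    ((min n m : ℕ) : ℝ) ≤
      mapNorm (amplify (min n m) (cornerTranspose (m := m) hn).toLinearMap) := by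
  set Y := amplify (min n m) (cornerTranspose (m := m) hn).toLinearMap
    (partialFlip (min n m) n) with hY
  let f : Fin (min n m) → Fin (min n m) × Fin m := fun a => (a, Fin.castLE (min_le_right _ _) a)
  have hf : f.Injective := fun a b h => (Prod.ext_iff.1 h).1
  have e : Y.submatrix f f = Matrix.of fun _ _ => 1 := by
    ext a b
    rw [Matrix.submatrix_apply, hY, amplify_eq_ampl, ampl_apply]
    refine (cornerTranspose_corner hn _ a b).trans ?_
    simp [partialFlip, f]
  calc ((min n m : ℕ) : ℝ) ≤ ‖Y.submatrix f f‖ := e ▸ card_le_norm_of_one _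
    _ ≤ ‖Y‖ := norm_submatrix_le _ hf hf
    _ ≤ _ := norm_apply_le_mapNorm _ _
    _ ≤ _ := mul_le_of_le_one_right (norm_nonneg _) (norm_partialFlip_le_one _ _)

end Extremal

/-! ### The cb norms and the conclusion -/

theorem cbNorm_le_min {n m : ℕ} (hn : 1 ≤ n) (Φ : MatAlg n →ₚ[ℂ] MatAlg m)
    (h : mapNorm Φ.toLinearMap ≤ 1) : cbNorm Φ.toLinearMap ≤ ((min n m : ℕ) : ℝ≥0∞) := by
  refine iSup_le fun k => ENNReal.ofReal_le_natCast.2 ?_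
  rw [Nat.cast_min]
  exact le_min (mapNorm_amplify_le_domain hn k Φ h) (mapNorm_amplify_le_codomain k _ h)

theorem cbNorm_cornerTranspose {n m : ℕ} (hn : 1 ≤ n) (hm : 1 ≤ m) :
    cbNorm (cornerTranspose (m := m) hn).toLinearMap = ((min n m : ℕ) : ℝ≥0∞) := by
  refine le_antisymm (cbNorm_le_min hn _ (mapNorm_le_one_of_unital _ (cornerTranspose_one hn))) ?_
  refine le_iSup_of_le (min n m) ((ENNReal.natCast_le_ofReal (by omega)).2 ?_)
  exact min_le_mapNorm_amplify_cornerTranspose hn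

theorem mainTheorem4 (n m : ℕ) (hn : 1 ≤ n) (hm : 1 ≤ m) :
    gammaMat n m = 1 / ((min n m : ℕ) : ℝ≥0∞) ∧
    etaMat n m = ((min n m : ℕ) : ℝ≥0∞) ∧
    etaUnitalMat n m = ((min n m : ℕ) : ℝ≥0∞) ∧
    (∃ Φ : MatAlg n →ₚ[ℂ] MatAlg m, mapNorm Φ.toLinearMap ≤ 1 ∧
      cbNorm Φ.toLinearMap = ((min n m : ℕ) : ℝ≥0∞)) ∧
    (∃ Φ : MatAlg n →ₚ[ℂ] MatAlg m, Φ 1 = 1 ∧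
      cbNorm Φ.toLinearMap = ((min n m : ℕ) : ℝ≥0∞)) := by
  have hT := cbNorm_cornerTranspose hn hm
  have h1 := cornerTranspose_one (m := m) hn
  have hc := mapNorm_le_one_of_unital _ h1
  refine ⟨gammaMat_eq hn hm, le_antisymm ?_ ?_, le_antisymm ?_ ?_, ⟨_, hc, hT⟩, ⟨_, h1, hT⟩⟩
  · exact iSup₂_le fun Φ h => cbNorm_le_min hn Φ h
  · exact le_iSup₂_of_le _ hc hT.ge
  · exact iSup₂_le fun Φ h => cbNorm_le_min hn Φ (mapNorm_le_one_of_unital Φ h)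
  · exact le_iSup₂_of_le _ h1 hT.ge
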